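/- Let $G_0\le G_1\le G_2\le\cdots$ be a chain of finite groups. Let $R(G)$ denote the representation ring of $G$ with complex coefficients (the Grothendieck group of finite-dimensional complex representations of $G$, tensored with $\mathbb C$). For $l\le n$ let $\mathrm{Ind}^l\,\mathrm{Res}^l$ be the linear operator on $R(G_n)$ that restricts from $G_n$ to $G_{n-l}$ and then induces back to $G_n$; write $\mathrm{Ind}\,\mathrm{Res}$ when $l=1$. Assume: * the chain is surjective: $\mathrm{Res}\colon R(G_n)\to R(G_{n-1})$ is a surjective linear map for all $n\ge 1$; * the chain is non-constant: $G_{n-1}\ne G_n$ for at least one $n\ge1$; * Property $(*)$: there are polynomials $f_l\in\mathbb Q[X]$ ($l\ge 1$) such that $\mathrm{Ind}^l\,\mathrm{Res}^l=f_l(\mathrm{Ind}\,\mathrm{Res})$ on $R(G_n)$ for all $n\ge l\ge 1$. For $n\ge1$ let $\chi_{\mathrm{Ind}(t)}$ be the character of the representation of $G_n$ induced from the trivial representation $t$ of $G_{n-1}$, and let $a_n=|G_n|/|G_{n-1}|$. For $h\in G_j$ let $[h]_j$ be the conjugacy class of $h$ in $G_j$. Then: 1. For all $n\ge l\ge 1$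 and all $h\in G_{n-l}$, $$\chi_{\mathrm{Ind}(t)}(h)=\frac{|G_n|\cdot|[h]_{n-1}|}{|G_{n-1}|\cdot|[h]_n|},\qquad f_l\bigl(\chi_{\mathrm{Ind}(t)}(h)\bigr)=\frac{|G_n|\cdot|[h]_{n-l}|}{|G_{n-l}|\cdot|[h]_n|},$$ where $\chi_{\mathrm{Ind}(t)}$ is the character of $G_n$. 2. The set $\{a_n : n\ge1\}$ is infinite, and there are integers $B,C$ such that $a_n=B\,a_{n-1}+C$ for all $n\ge 2$. 3. For any integers $B,C$ such that $a_n=B\,a_{n-1}+C$ for all $n\ge 2$, one has $B>0$ and, for every $l\ge 1$, $$f_l(X)=\frac{1}{B^{l(l-1)/2}}\prod_{j=0}^{l-1}\Bigl(X-\bigl(1+B+\cdots+B^{j-1}\bigr)C\Bigr),$$ where the factor for $j=0$ is $X$. 4. Suppose $G_0$ is trivial. Then for every $l\ge1$ and every $g\in G_l$ with $g\neq 1$, the value $\chi_{\mathrm{Ind}(t)}(g)$ of the character of $G_l$ is a root of $f_l$. If moreover $G_1$ is non-trivial, then for every $l\ge 1$ the set of complex roots of $f_l$ is exactly $\{\chi_{\mathrm{Ind}(t)}(g)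 : g\in G_l,\ g\ne1\}$, and this set is also the set of values of $\chi_{\mathrm{Ind}(t)}$ on $G_l$ other than $\chi_{\mathrm{Ind}(t)}(1)=\dim \mathrm{Ind}(t)$. -/

import Mathlib

open Polynomial

universe u

/-- A finite-dimensional complex representation of `G`. -/
structure FinRep (G : Type u) [Group G] where
  V : Type u
  [addCommGroup : AddCommGroup V]
  [module : Module ℂ V]
  [finiteDimensional : FiniteDimensional ℂ V]
  ρ : Representation ℂ G V

attribute [instance] FinRep.addCommGroup FinRep.module FinRep.finiteDimensional

namespace FinRep

variable {G H : Type u} [Group G] [Group H]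

/-- `V` is isomorphic, as a representation, to the direct sum of `A` and `B`. -/
def IsDirectSum (V A B : FinRep G) : Prop :=
  Nonempty (V.ρ.Equiv (A.ρ.prod B.ρ))

/-- The restriction of a representation of `H` along `φ : G →* H`. -/
def res (φ : G →* H) (V : FinRep H) : FinRep G where
  V := V.V
  ρ := V.ρ.comp φ

theorem IsDirectSum.res (φ : G →* H) {V A B : FinRep H} (h : IsDirectSum V A B) :
    IsDirectSum (V.res φ) (A.res φ) (B.res φ) :=
  h.map fun e => Representation.Equiv.mk e.toLinearEquiv fun g => e.isIntertwining' (φ g)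

/-- The representation `ℂ[H] ⊗_{ℂ[G]} V` of the finite group `H` induced from the representation
`V` of `G` along `φ : G →* H`. -/
noncomputable def ind [Finite H] (φ : G →* H) (V : FinRep G) : FinRep H :=
  haveI : FiniteDimensional ℂ (MonoidAlgebra ℂ H) :=
    Module.Finite.equiv (MonoidAlgebra.coeffLinearEquiv ℂ).symm
  haveI : FiniteDimensional ℂ (Representation.IndV φ V.ρ) :=
    Module.Finite.of_surjective (Representation.Coinvariants.mk _)
      (Representation.Coinvariants.mk_surjective _)
  { V := Representation.IndV φ V.ρ
    ρ := Representation.ind φ V.ρ }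

/-- The linear map between induced representations given by an intertwining map. -/
noncomputable def indMap (φ : G →* H) {V W : Type u} [AddCommGroup V] [Module ℂ V]
    [AddCommGroup W] [Module ℂ W] {ρ : Representation ℂ G V} {σ : Representation ℂ G W}
    (f : ρ.IntertwiningMap σ) : Representation.IndV φ ρ →ₗ[ℂ] Representation.IndV φ σ :=
  Representation.Coinvariants.map _ _ ⟨f.toLinearMap.lTensor _, by
    simp [LinearMap.lTensor_comp_map, f.2, LinearMap.map_comp_lTensor]⟩

theorem indMap_mk (φ : G →* H) {V W : Type u} [AddCommGroup V] [Module ℂ V]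
    [AddCommGroup W] [Module ℂ W] {ρ : Representation ℂ G V} {σ : Representation ℂ G W}
    (f : ρ.IntertwiningMap σ) (h : H) (v : V) :
    indMap φ f (Representation.IndV.mk φ ρ h v) = Representation.IndV.mk φ σ h (f v) := by
  simp [indMap]

theorem ind_hom_ext (φ : G →* H) {V W : Type u} [AddCommGroup V] [Module ℂ V]
    [AddCommGroup W] [Module ℂ W] {ρ : Representation ℂ G V}
    {f g : Representation.IndV φ ρ →ₗ[ℂ] W}
    (hfg : ∀ h v, f (Representation.IndV.mk φ ρ h v) = g (Representation.IndV.mk φ ρ h v)) :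
    f = g :=
  Representation.IndV.hom_ext φ ρ fun h => LinearMap.ext fun v => hfg h v

theorem IsDirectSum.ind [Finite H] (φ : G →* H) {V A B : FinRep G} (h : IsDirectSum V A B) :
    IsDirectSum (V.ind φ) (A.ind φ) (B.ind φ) := by
  obtain ⟨e⟩ := h
  let p := (Representation.IntertwiningMap.fst ℂ A.ρ B.ρ).comp e.toIntertwiningMap
  let q := (Representation.IntertwiningMap.snd ℂ A.ρ B.ρ).comp e.toIntertwiningMap
  let i := e.symm.toIntertwiningMap.comp (Representation.IntertwiningMap.inl ℂ A.ρ B.ρ)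
  let j := e.symm.toIntertwiningMap.comp (Representation.IntertwiningMap.inr ℂ A.ρ B.ρ)
  have hi (a : A.V) : e (i a) = (a, 0) := e.toLinearEquiv.apply_symm_apply (a, 0)
  have hj (b : B.V) : e (j b) = (0, b) := e.toLinearEquiv.apply_symm_apply (0, b)
  have hij (v : V.V) : i (p v) + j (q v) = v := by
    apply e.toLinearEquiv.injective
    change e (i (p v) + j (q v)) = e v
    rw [map_add, hi, hj]
    change ((e v).1, (0 : B.V)) + ((0 : A.V), (e v).2) = e v
    simp
  have hpi (a : A.V) : p (i a) = a := congrArg Prod.fst (hi a)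
  have hqi (a : A.V) : q (i a) = 0 := congrArg Prod.snd (hi a)
  have hpj (b : B.V) : p (j b) = 0 := congrArg Prod.fst (hj b)
  have hqj (b : B.V) : q (j b) = b := congrArg Prod.snd (hj b)
  let E : Representation.IndV φ V.ρ ≃ₗ[ℂ]
      Representation.IndV φ A.ρ × Representation.IndV φ B.ρ :=
    LinearEquiv.ofLinearMap ((indMap φ p).prod (indMap φ q)) ((indMap φ i).coprod (indMap φ j))
      (by
        refine LinearMap.prod_ext (ind_hom_ext φ fun h a => ?_) (ind_hom_ext φ fun h b => ?_)
        · rw [LinearMap.comp_assoc, LinearMap.coprod_inl]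
          change (indMap φ p (indMap φ i _), indMap φ q (indMap φ i _)) = (_, 0)
          rw [indMap_mk, indMap_mk, indMap_mk, hpi, hqi, map_zero, LinearMap.id_apply]
        · rw [LinearMap.comp_assoc, LinearMap.coprod_inr]
          change (indMap φ p (indMap φ j _), indMap φ q (indMap φ j _)) = (0, _)
          rw [indMap_mk, indMap_mk, indMap_mk, hpj, hqj, map_zero, LinearMap.id_apply])
      (by
        refine ind_hom_ext φ fun h v => ?_
        change indMap φ i (indMap φ p (Representation.IndV.mk φ V.ρ h v)) +
          indMap φ j (indMap φ q (Representation.IndV.mk φ V.ρ h v)) = _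
        rw [indMap_mk, indMap_mk, indMap_mk, indMap_mk, ← map_add, hij, LinearMap.id_apply])
  refine ⟨Representation.Equiv.mk E fun x => ind_hom_ext φ fun h v => ?_⟩
  change (indMap φ p (Representation.ind φ V.ρ x (Representation.IndV.mk φ V.ρ h v)),
      indMap φ q (Representation.ind φ V.ρ x (Representation.IndV.mk φ V.ρ h v))) =
    (Representation.ind φ A.ρ x (indMap φ p (Representation.IndV.mk φ V.ρ h v)),
      Representation.ind φ B.ρ x (indMap φ q (Representation.IndV.mk φ V.ρ h v)))
  rw [Representation.ind_mk, indMap_mk, indMap_mk, indMap_mk, indMap_mk, Representation.ind_mk,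
    Representation.ind_mk]

end FinRep

/-- The relations `[V] = [A] + [B]` for `V ≅ A ⊕ B`, as a subspace of the free vector space on all
finite-dimensional representations. -/
noncomputable def repRelations (G : Type u) [Group G] : Submodule ℂ (FinRep G →₀ ℂ) :=
  Submodule.span ℂ {x | ∃ V A B : FinRep G, FinRep.IsDirectSum V A B ∧
    x = Finsupp.single V 1 - Finsupp.single A 1 - Finsupp.single B 1}

/-- The representation ring `R(G)` with complex coefficients, as a vector space: the Grothendieck
group of finite-dimensional complex representations of `G`, tensored with `ℂ`. -/
abbrev RepRing (G : Type u) [Group G] : Type (u + 1) :=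
  (FinRep G →₀ ℂ) ⧸ repRelations G

namespace RepRing

variable {G H : Type u} [Group G] [Group H]

/-- The class `[V]` in `R(G)`. -/
noncomputable def cls (V : FinRep G) : RepRing G :=
  (repRelations G).mkQ (Finsupp.single V 1)

/-- A map on representations that respects direct sums extends to a linear map `[V] ↦ [F V]`. -/
noncomputable def lift (F : FinRep G → FinRep H)
    (hF : ∀ V A B, FinRep.IsDirectSum V A B → FinRep.IsDirectSum (F V) (F A) (F B)) :
    RepRing G →ₗ[ℂ] RepRing H :=
  (repRelations G).mapQ (repRelations H) (Finsupp.lmapDomain ℂ ℂ F) (by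
    rw [repRelations, Submodule.span_le]
    rintro _ ⟨V, A, B, h, rfl⟩
    refine Submodule.subset_span ⟨F V, F A, F B, hF V A B h, ?_⟩
    simp only [map_sub, Finsupp.lmapDomain_apply, Finsupp.mapDomain_single])

/-- `Res : R(H) → R(G)` along `φ : G →* H`. -/
noncomputable def Res (φ : G →* H) : RepRing H →ₗ[ℂ] RepRing G :=
  lift (FinRep.res φ) fun _ _ _ => FinRep.IsDirectSum.res φ

/-- `Ind : R(G) → R(H)` along `φ : G →* H`. -/
noncomputable def Ind [Finite H] (φ : G →* H) : RepRing G →ₗ[ℂ] RepRing H :=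
  lift (FinRep.ind φ) fun _ _ _ => FinRep.IsDirectSum.ind φ

theorem Res_cls (φ : G →* H) (V : FinRep H) : Res φ (cls V) = cls (V.res φ) := by
  simp [Res, lift, cls, Finsupp.mapDomain_single]

theorem Ind_cls [Finite H] (φ : G →* H) (V : FinRep G) : Ind φ (cls V) = cls (V.ind φ) := by
  simp [Ind, lift, cls, Finsupp.mapDomain_single]

end RepRing

/-- A chain `G₀ ≤ G₁ ≤ G₂ ≤ ⋯` of finite groups, with the inclusions `G m ≤ G n` for `m ≤ n`. -/
structure GroupChain where
  G : ℕ → Type u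
  [group : ∀ n, Group (G n)]
  [finite : ∀ n, Finite (G n)]
  incl : ∀ {m n : ℕ}, m ≤ n → (G m →* G n)
  incl_injective : ∀ {m n : ℕ} (h : m ≤ n), Function.Injective (incl h)
  incl_refl : ∀ (n : ℕ) (x : G n), incl (le_refl n) x = x
  incl_trans : ∀ {k m n : ℕ} (h : k ≤ m) (h' : m ≤ n) (x : G k),
    incl h' (incl h x) = incl (h.trans h') x

attribute [instance] GroupChain.group GroupChain.finite

namespace GroupChain

variable (S : GroupChain.{u})

/-- All the inclusions are equalities. -/
def IsConstant : Prop :=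
  ∀ n, Function.Surjective (S.incl (Nat.le_succ n))

/-- The chain is surjective: each `Res : R(G (n + 1)) → R(G n)` is onto. -/
def IsSurjective : Prop :=
  ∀ n, Function.Surjective (RepRing.Res (S.incl (Nat.le_succ n)))

/-- The operator `Ind^l Res^l` on `R(G n)`, for `l ≤ n`: restriction to `G (n - l)` followed by
induction back to `G n`. -/
noncomputable def indRes (l n : ℕ) : Module.End ℂ (RepRing (S.G n)) :=
  RepRing.Ind (S.incl (Nat.sub_le n l)) ∘ₗ RepRing.Res (S.incl (Nat.sub_le n l))

/-- The polynomials `f l`, `l ≥ 1`, satisfy `Ind^l Res^l = f l (Ind Res)` on every `R(G n)` with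
`n ≥ l`. -/
def HasPolynomials (f : ℕ → ℚ[X]) : Prop :=
  ∀ l n : ℕ, 1 ≤ l → l ≤ n →
    S.indRes l n = aeval (S.indRes 1 n) ((f l).map (algebraMap ℚ ℂ))

/-- The character of the representation `Ind t` of `G n` (for `n ≥ 1`) that is induced from the
trivial representation `t` of `G (n - 1)`. -/
noncomputable def chiIndTriv (n : ℕ) : S.G n → ℂ :=
  (Representation.ind (S.incl (Nat.sub_le n 1))
    (Representation.trivial ℂ (S.G (n - 1)) ℂ)).character

/-- The order of `G n`. -/
noncomputable def order (n : ℕ) : ℕ := Nat.card (S.G n)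

/-- The number of elements of the conjugacy class in `G n` of an element of `G m`, `m ≤ n`. -/
noncomputable def classCard {m n : ℕ} (hmn : m ≤ n) (h : S.G m) : ℕ :=
  Nat.card (conjugatesOf (S.incl hmn h))

/-- `a n = |G n| / |G (n - 1)|`, for `n ≥ 1`. -/
noncomputable def a (n : ℕ) : ℚ := (S.order n : ℚ) / S.order (n - 1)

end GroupChain

/-! On characters, restricting and then inducing along an inclusion is multiplication by the
permutation character `permChar` (the projection formula). Property (*) applied to the trivial
representation therefore says, pointwise, that `f l` sends the value of the permutation character of
G n over G (n-1) to that of G n over G (n-l) (`HasPolynomials.eval_permChar`). Since characters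
separate classes, surjectivity of `Res` makes the inclusions reflect conjugacy. Hence permutation
characters are ratios of centralizer orders on the smaller group, which is (1); they vanish off its
conjugates, and a proper subgroup always misses some class.

For h in G m let c_k be the index of its centralizer in G (m+k) inside that in G (m+k+1). Then
f_2(c_{k+1}) = c_{k+1} c_k, and f_2(c_0) = 0 if h is not conjugate into G (m-1). If the a_n took
finitely many values, so would the c_k, being at most a_{m+k+1}; then c_0 would recur as some
c_{j+1}, and f_2(c_0) would be non-zero. So the indices are infinite in number. Now f_2 = X g with
g(a_n) = a_{n-1}, and growth forces g to be affine: this is the recurrence. Each f_l is determined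
by its values at infinitely many a_n, where it is a product of l consecutive indices.

When G 0 is trivial, f_l takes the values of the character of Ind t to the regular character of G l,
which vanishes exactly off 1. Conversely, the root (1+⋯+B^{j-1})C is attained at an element of G
(l-j) not conjugate into G (l-j-1). -/

open Module in
theorem LinearMap.trace_restrict_maxGenEigenspace {V : Type*} [AddCommGroup V] [Module ℂ V]
    [FiniteDimensional ℂ V] (T : Module.End ℂ V) (μ : ℂ) :
    LinearMap.trace ℂ _ (T.restrict (T.mapsTo_maxGenEigenspace_of_comm rfl μ)) =
      μ * finrank ℂ (T.maxGenEigenspace μ) := by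
  have hN := T.isNilpotent_restrict_maxGenEigenspace_sub_algebraMap μ
  have h : T.restrict (T.mapsTo_maxGenEigenspace_of_comm rfl μ) - μ • LinearMap.id =
      (T - algebraMap ℂ (Module.End ℂ V) μ).restrict
        (Module.End.mapsTo_maxGenEigenspace_of_comm (Algebra.mul_sub_algebraMap_commutes T μ) μ) :=
    LinearMap.ext fun _ => Subtype.ext rfl
  rw [← h] at hN
  have := (LinearMap.isNilpotent_trace_of_isNilpotent hN).eq_zero
  rwa [map_sub, sub_eq_zero, map_smul, LinearMap.trace_id, smul_eq_mul] at this

/-- The trace on the generalized eigenspace of μ is μ times its dimension, so only μ = 0 survives.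
-/
theorem Module.End.isNilpotent_of_trace_restrict_maxGenEigenspace {V : Type*} [AddCommGroup V]
    [Module ℂ V] [FiniteDimensional ℂ V] (T : Module.End ℂ V)
    (h : ∀ μ, LinearMap.trace ℂ _
      (T.restrict (T.mapsTo_maxGenEigenspace_of_comm rfl μ)) = 0) : IsNilpotent T := by
  have h0 : T.maxGenEigenspace 0 = ⊤ := by
    rw [eq_top_iff, ← Module.End.iSup_maxGenEigenspace_eq_top T, iSup_le_iff]
    intro μ
    rcases eq_or_ne μ 0 with rfl | hμ
    · exact le_rfl
    · have := h μ
      rw [LinearMap.trace_restrict_maxGenEigenspace, mul_eq_zero, or_iff_right hμ,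
        Nat.cast_eq_zero, Submodule.finrank_eq_zero] at this
      rw [this]
      exact bot_le
  refine ⟨Module.finrank ℂ V, LinearMap.ext fun v => ?_⟩
  have hv : v ∈ T.maxGenEigenspace 0 := h0 ▸ Submodule.mem_top
  rw [Module.End.maxGenEigenspace_eq_genEigenspace_finrank, Module.End.mem_genEigenspace_nat,
    LinearMap.mem_ker, zero_smul, sub_zero] at hv
  exact hv

/-! ### Characters separate conjugacy classes -/

section Separation

variable {G : Type u} [Group G]

/-- The complex functions on `G`, with `G` acting by left translation. -/
noncomputable def translationRep (G : Type u) [Group G] : Representation ℂ G (G → ℂ) where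
  toFun g := LinearMap.funLeft ℂ ℂ (fun x => g⁻¹ * x)
  map_one' := by ext; simp [LinearMap.funLeft_apply]
  map_mul' x y := by ext; simp [LinearMap.funLeft_apply, mul_assoc]

theorem translationRep_trace [Fintype G] [DecidableEq G] (g : G) :
    LinearMap.trace ℂ _ (translationRep G g) = if g = 1 then (Fintype.card G : ℂ) else 0 := by
  rw [LinearMap.trace_eq_matrix_trace ℂ (Pi.basisFun ℂ G), Matrix.trace]
  have (x : G) : (LinearMap.toMatrix (Pi.basisFun ℂ G) (Pi.basisFun ℂ G)
      (translationRep G g)).diag x = if g = 1 then 1 else 0 := by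
    simp [translationRep, LinearMap.funLeft_apply, Pi.single_apply]
  rw [Finset.sum_congr rfl fun x _ => this x]
  simp

/-- The difference of the averages of a representation over two conjugacy classes. -/
noncomputable def conjDiff [Fintype G] {V : Type*} [AddCommGroup V] [Module ℂ V]
    (ρ : Representation ℂ G V) (a b : G) : Module.End ℂ V :=
  ∑ x : G, (ρ (x * a * x⁻¹) - ρ (x * b * x⁻¹))

theorem conjDiff_commute [Fintype G] {V : Type*} [AddCommGroup V] [Module ℂ V]
    (ρ : Representation ℂ G V) (a b y : G) : Commute (conjDiff ρ a b) (ρ y) := by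
  rw [Commute, SemiconjBy, conjDiff, Finset.sum_mul, Finset.mul_sum,
    ← Fintype.sum_equiv (Equiv.mulLeft y) (fun x => (ρ (y * x * a * (y * x)⁻¹) -
      ρ (y * x * b * (y * x)⁻¹)) * ρ y) _ fun _ => rfl]
  refine Finset.sum_congr rfl fun x _ => ?_
  simp [sub_mul, mul_sub, ← map_mul, mul_assoc]

theorem trace_conjDiff [Fintype G] {V : Type*} [AddCommGroup V] [Module ℂ V]
    (ρ : Representation ℂ G V) {a b : G} (h : ρ.character a = ρ.character b) :
    LinearMap.trace ℂ V (conjDiff ρ a b) = 0 := by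
  rw [conjDiff, map_sum]
  refine Finset.sum_eq_zero fun x _ => ?_
  rw [map_sub, sub_eq_zero]
  change ρ.character _ = ρ.character _
  rw [Representation.char_conj, Representation.char_conj, h]

/-- Characters separate conjugacy classes. -/
theorem isConj_of_forall_character_eq [Finite G] {a b : G}
    (h : ∀ V : FinRep G, V.ρ.character a = V.ρ.character b) : IsConj a b := by
  classical
  have := Fintype.ofFinite G
  let ρ := translationRep G
  let T := conjDiff ρ a b
  have hT : IsNilpotent T := by
    -- `T` commutes with G, so its generalized eigenspaces are subrepresentations, to which the
    -- hypothesis on characters applies.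
    refine Module.End.isNilpotent_of_trace_restrict_maxGenEigenspace T fun μ => ?_
    let W : Subrepresentation ρ := ⟨T.maxGenEigenspace μ, fun g _ hv =>
      T.mapsTo_maxGenEigenspace_of_comm (conjDiff_commute ρ a b g) μ hv⟩
    have key := trace_conjDiff W.toRepresentation
      (h { V := T.maxGenEigenspace μ, ρ := W.toRepresentation })
    convert key using 2
    refine LinearMap.ext fun v => Subtype.ext ?_
    change T v.1 = (T.maxGenEigenspace μ).subtype (conjDiff W.toRepresentation a b v)
    rw [conjDiff, LinearMap.sum_apply, map_sum]
    simp only [T, conjDiff, LinearMap.sum_apply]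
    rfl
  -- The shift by a⁻¹ brings the class of a onto the identity, the only element with non-zero
  -- regular trace.
  have hN : IsNilpotent (ρ a⁻¹ * T) :=
    (conjDiff_commute ρ a b a⁻¹).symm.isNilpotent_mul_left hT
  have h0 := (LinearMap.isNilpotent_trace_of_isNilpotent hN).eq_zero
  by_contra hab
  have hb (x : G) : a⁻¹ * (x * b * x⁻¹) ≠ 1 := fun hx => hab <| by
    rw [isConj_comm, isConj_iff]
    exact ⟨x, (inv_mul_eq_one.mp hx).symm⟩
  simp only [T, conjDiff, Finset.mul_sum, mul_sub, ← map_mul, map_sum, map_sub, ρ,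
    translationRep_trace, hb, if_false, sub_zero] at h0
  rw [← Finset.sum_filter, Finset.sum_const, nsmul_eq_mul, mul_eq_zero, Nat.cast_eq_zero,
    Finset.card_eq_zero, Nat.cast_eq_zero, or_iff_left Fintype.card_ne_zero,
    Finset.filter_eq_empty_iff] at h0
  exact h0 (Finset.mem_univ 1) (by simp)

end Separation

/-! ### Characters of induced representations -/

section InducedCharacter

namespace Representation

-- Averaging over G gives a section s of the projection to coinvariants, so the induced map is mk ∘
-- T ∘ s; cyclicity of the trace moves it to V.
open Coinvariants in
theorem Coinvariants.trace_map {G V : Type*} [Group G] [Fintype G] [AddCommGroup V] [Module ℂ V]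
    [FiniteDimensional ℂ V] (ρ : Representation ℂ G V) (T : IntertwiningMap ρ ρ) :
    LinearMap.trace ℂ _ (Coinvariants.map ρ ρ T) =
      (Fintype.card G : ℂ)⁻¹ * ∑ g, LinearMap.trace ℂ V (T.toLinearMap * ρ g) := by
  let s : Coinvariants ρ →ₗ[ℂ] V :=
    Coinvariants.lift ρ ((Fintype.card G : ℂ)⁻¹ • ∑ g, ρ g) fun x => by
      rw [LinearMap.smul_comp, ← Module.End.mul_eq_comp, Finset.sum_mul,
        ← Fintype.sum_equiv (Equiv.mulRight x) (fun g => ρ g * ρ x) _ fun g => (map_mul ρ g x).symm]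
  have hs : Coinvariants.mk ρ ∘ₗ s = LinearMap.id := by
    refine Coinvariants.hom_ext (LinearMap.ext fun v => ?_)
    simp [s, LinearMap.sum_apply, Coinvariants.mk_self_apply, ← Nat.cast_smul_eq_nsmul ℂ, smul_smul]
  have hT : Coinvariants.map ρ ρ T = (Coinvariants.mk ρ ∘ₗ T.toLinearMap) ∘ₗ s := by
    change _ = (Coinvariants.map ρ ρ T ∘ₗ Coinvariants.mk ρ) ∘ₗ s
    rw [LinearMap.comp_assoc, hs, LinearMap.comp_id]
  rw [hT, LinearMap.trace_comp_comm', ← LinearMap.comp_assoc, LinearMap.trace_comp_comm',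
    Coinvariants.lift_comp_mk, LinearMap.comp_smul, map_smul,
    ← Module.End.mul_eq_comp, Finset.mul_sum, map_sum, smul_eq_mul]

theorem trace_mapDomainLinearMap {H : Type*} [Fintype H] [DecidableEq H] (f : H → H) :
    LinearMap.trace ℂ _ (MonoidAlgebra.mapDomainLinearMap ℂ ℂ f) =
      ((Finset.univ.filter fun y => f y = y).card : ℂ) := by
  rw [LinearMap.trace_eq_matrix_trace ℂ (MonoidAlgebra.basis H ℂ), Matrix.trace]
  have (x : H) : (LinearMap.toMatrix (MonoidAlgebra.basis H ℂ) (MonoidAlgebra.basis H ℂ)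
      (MonoidAlgebra.mapDomainLinearMap ℂ ℂ f)).diag x = if f x = x then 1 else 0 := by
    simp [LinearMap.toMatrix_apply, MonoidAlgebra.basis, Finsupp.single_apply]
  rw [Finset.sum_congr rfl fun x _ => this x, Finset.sum_boole]

/-- The trace on ℂ[H] ⊗ V factors, and on ℂ[H] it counts the fixed points of y ↦ φ(g) y x⁻¹. -/
theorem character_ind {G H V : Type*} [Group G] [Group H] [Fintype G] [Fintype H] [DecidableEq H]
    [AddCommGroup V] [Module ℂ V] [FiniteDimensional ℂ V] (φ : G →* H)
    (ρ : Representation ℂ G V) (x : H) :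
    (ind φ ρ).character x = (Fintype.card G : ℂ)⁻¹ *
      ∑ g, ((Finset.univ.filter fun y => φ g * y * x⁻¹ = y).card : ℂ) * ρ.character g := by
  have : FiniteDimensional ℂ (MonoidAlgebra ℂ H) :=
    Module.Finite.equiv (MonoidAlgebra.coeffLinearEquiv ℂ).symm
  rw [character, ind_apply, Coinvariants.trace_map]
  congr 1
  refine Finset.sum_congr rfl fun g _ => ?_
  rw [character, ← trace_mapDomainLinearMap, ← smul_eq_mul, ← LinearMap.trace_tensorProduct']
  congr 1
  ext
  simp [mul_assoc]

end Representation

end InducedCharacter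

/-! ### Classes, centralizers and permutation characters -/

section Conjugation

variable {G H : Type*} [Group G] [Group H]

theorem card_conjugatesOf_mul_card_centralizer [Finite H] (x : H) :
    Nat.card (conjugatesOf x) * Nat.card (Subgroup.centralizer {x}) = Nat.card H := by
  have : conjugatesOf x = MulAction.orbit (ConjAct H) x := by
    rw [ConjAct.orbit_eq_carrier_conjClasses, ConjClasses.carrier_eq_preimage_mk]
    ext y
    rw [Set.mem_preimage, Set.mem_singleton_iff, ConjClasses.mk_eq_mk_iff_isConj, isConj_comm]
    rfl
  rw [this, Subgroup.nat_card_centralizer_nat_card_stabilizer, ← Nat.card_prod,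
    Nat.card_congr (MulAction.orbitProdStabilizerEquivGroup (ConjAct H) x)]
  rfl

theorem card_conjugatesOf_pos [Finite H] (x : H) : 0 < Nat.card (conjugatesOf x) :=
  have : Nonempty (conjugatesOf x) := ⟨x, mem_conjugatesOf_self⟩
  Nat.card_pos

/-- The solutions of z y = y x form a left coset of the centralizer of x. -/
theorem card_filter_mul_mul_inv_eq [Fintype H] [DecidableEq H] {x z : H} (h : IsConj z x) :
    (Finset.univ.filter fun y => z * y * x⁻¹ = y).card =
      Nat.card (Subgroup.centralizer {x}) := by
  obtain ⟨y₀, rfl⟩ := isConj_iff.mp h.symm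
  rw [← Fintype.card_subtype, ← Nat.card_eq_fintype_card]
  refine Nat.card_congr ((Equiv.mulLeft y₀⁻¹).subtypeEquiv fun y => ?_)
  rw [Subgroup.mem_centralizer_singleton_iff, mul_inv_eq_iff_eq_mul, Equiv.coe_mulLeft]
  constructor <;> intro h
  · rw [mul_assoc, ← h]
    group
  · have := congrArg (y₀ * ·) h
    simp only [mul_assoc, mul_inv_cancel_left] at this
    rw [this]
    group

/-- The value at `x` of the character of the representation induced along `φ` from the trivial
representation. -/
noncomputable def permChar (φ : G →* H) (x : H) : ℚ :=
  Nat.card {g // IsConj (φ g) x} * Nat.card (Subgroup.centralizer {x}) / Nat.card G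

theorem permChar_eq_zero {φ : G →* H} {x : H} (h : ∀ g, ¬ IsConj (φ g) x) : permChar φ x = 0 := by
  have : IsEmpty {g // IsConj (φ g) x} := ⟨fun g => h g.1 g.2⟩
  rw [permChar, Nat.card_of_isEmpty, Nat.cast_zero, zero_mul, zero_div]

theorem permChar_apply_of_reflects [Finite G] {φ : G →* H}
    (hφ : ∀ a b, IsConj (φ a) (φ b) → IsConj a b) (h : G) :
    permChar φ (φ h) = (Nat.card (Subgroup.centralizer {φ h}) : ℚ) /
      Nat.card (Subgroup.centralizer {h}) := by
  have : Nat.card {g // IsConj (φ g) (φ h)} = Nat.card (conjugatesOf h) :=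
    Nat.card_congr (Equiv.subtypeEquivRight fun g => by
      exact ⟨fun hg => (hφ g h hg).symm, fun hg => φ.map_isConj (IsConj.symm hg)⟩)
  have h1 : (0 : ℚ) < Nat.card (conjugatesOf h) := Nat.cast_pos.mpr (card_conjugatesOf_pos h)
  have h2 : (0 : ℚ) < Nat.card (Subgroup.centralizer {h}) := Nat.cast_pos.mpr Nat.card_pos
  rw [permChar, this, ← card_conjugatesOf_mul_card_centralizer h, Nat.cast_mul]
  field_simp

theorem card_centralizer_dvd [Finite H] {φ : G →* H} (hφ : Function.Injective φ) (h : G) :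
    Nat.card (Subgroup.centralizer {h}) ∣ Nat.card (Subgroup.centralizer {φ h}) := by
  rw [← Subgroup.card_map_of_injective hφ]
  refine Subgroup.card_dvd_of_le ?_
  rintro _ ⟨g, hg, rfl⟩
  rw [SetLike.mem_coe, Subgroup.mem_centralizer_singleton_iff] at hg
  rw [Subgroup.mem_centralizer_singleton_iff, ← map_mul, ← map_mul, hg]

theorem card_conjugatesOf_le [Finite H] {φ : G →* H} (hφ : Function.Injective φ) (h : G) :
    Nat.card (conjugatesOf h) ≤ Nat.card (conjugatesOf (φ h)) := by
  refine Nat.card_le_card_of_injective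
    (fun g => ⟨φ g.1, φ.map_isConj g.2⟩ : conjugatesOf h → conjugatesOf (φ h)) fun a b hab => ?_
  exact Subtype.ext (hφ (congrArg Subtype.val hab))

/-- The conjugates of a proper subgroup do not cover a finite group. -/
theorem Subgroup.exists_forall_conj_notMem [Finite H] (K : Subgroup H) (hK : K ≠ ⊤) :
    ∃ h : H, ∀ y, y * h * y⁻¹ ∉ K := by
  classical
  have := Fintype.ofFinite H
  by_contra! hc
  have hlt : Fintype.card K < Fintype.card H := by
    by_contra! hle
    exact hK (Subgroup.eq_top_of_le_card K (by simpa [Nat.card_eq_fintype_card] using hle))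
  -- If y₀ conjugates h into K, so does the whole coset K y₀. Double counting the pairs (h, y) then
  -- forces equality for every h, which fails at h = 1.
  have hge (h : H) : Fintype.card K ≤ (Finset.univ.filter fun y => y * h * y⁻¹ ∈ K).card := by
    obtain ⟨y₀, hy₀⟩ := hc h
    rw [← Fintype.card_subtype]
    refine Fintype.card_le_of_injective
      (fun k : K => ⟨k * y₀, ?_⟩ : K → {y // y * h * y⁻¹ ∈ K}) fun a b hab => ?_
    · have : (k : H) * y₀ * h * (k * y₀)⁻¹ = k * (y₀ * h * y₀⁻¹) * (k : H)⁻¹ := by group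
      rw [this]
      exact K.mul_mem (K.mul_mem k.2 hy₀) (K.inv_mem k.2)
    · exact Subtype.ext (mul_right_cancel (congrArg Subtype.val hab))
  have hsum : ∑ h : H, (Finset.univ.filter fun y => y * h * y⁻¹ ∈ K).card =
      ∑ _y : H, Fintype.card K := by
    simp only [Finset.card_filter]
    rw [Finset.sum_comm]
    refine Finset.sum_congr rfl fun y _ => ?_
    rw [← Finset.card_filter, ← Fintype.card_subtype]
    exact Fintype.card_congr ((MulAut.conj y).toEquiv.subtypeEquiv fun h => by simp)
  refine absurd hsum (Finset.sum_lt_sum (fun h _ => hge h) ⟨1, Finset.mem_univ _, ?_⟩).ne'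
  simpa using hlt

theorem exists_forall_not_isConj [Finite H] {φ : G →* H} (hφ : ¬ Function.Surjective φ) :
    ∃ h : H, ∀ g, ¬ IsConj (φ g) h := by
  obtain ⟨h, hh⟩ := φ.range.exists_forall_conj_notMem fun ht => hφ (MonoidHom.range_eq_top.mp ht)
  refine ⟨h, fun g hg => ?_⟩
  obtain ⟨y, hy⟩ := isConj_iff.mp hg.symm
  exact hh y ⟨g, hy.symm⟩

end Conjugation

/-- The projection formula: only g with φ(g) conjugate to x contribute, and there the character of ρ
has its value at x. -/
theorem Representation.character_ind_of_comp {G H V : Type*} [Group G] [Group H] [Finite G]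
    [Finite H] [AddCommGroup V] [Module ℂ V] [FiniteDimensional ℂ V] (φ : G →* H)
    (ρ : Representation ℂ H V) (x : H) :
    (ind φ (ρ.comp φ)).character x = permChar φ x * ρ.character x := by
  classical
  have := Fintype.ofFinite G
  have := Fintype.ofFinite H
  have (g : G) : ((Finset.univ.filter fun y => φ g * y * x⁻¹ = y).card : ℂ) *
      character (ρ.comp φ) g = if IsConj (φ g) x then
        (Nat.card (Subgroup.centralizer {x}) : ℂ) * ρ.character x else 0 := by
    split_ifs with h
    · obtain ⟨y, hy⟩ := isConj_iff.mp h.symm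
      have hchar : character (ρ.comp φ) g = ρ.character (φ g) := rfl
      rw [card_filter_mul_mul_inv_eq h, hchar, ← hy, char_conj]
    · rw [Finset.filter_false_of_mem, Finset.card_empty, Nat.cast_zero, zero_mul]
      intro y _ hy
      refine h (isConj_comm.mp (isConj_iff.mpr ⟨y, ?_⟩))
      rw [mul_inv_eq_iff_eq_mul] at hy
      rw [mul_inv_eq_iff_eq_mul, hy]
  rw [character_ind, Finset.sum_congr rfl fun g _ => this g, ← Finset.sum_filter,
    Finset.sum_const, ← Fintype.card_subtype, nsmul_eq_mul, permChar,
    Nat.card_eq_fintype_card (α := G), Nat.card_eq_fintype_card (α := {g // IsConj (φ g) x})]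
  push_cast
  ring

theorem Representation.character_trivial_complex {G : Type*} [Group G] (g : G) :
    (trivial ℂ G ℂ).character g = 1 := by
  change LinearMap.trace ℂ ℂ LinearMap.id = 1
  rw [LinearMap.trace_id, Module.finrank_self, Nat.cast_one]

/-! ### Characters on the representation ring -/

namespace RepRing

variable {G H : Type u} [Group G] [Group H]

theorem hom_ext {M : Type*} [AddCommGroup M] [Module ℂ M] {f g : RepRing G →ₗ[ℂ] M}
    (h : ∀ V, f (cls V) = g (cls V)) : f = g :=
  Submodule.linearMap_qext _ (Finsupp.lhom_ext' fun V => LinearMap.ext_ring (h V))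

/-- The character of an element of `R(G)`. -/
noncomputable def ch : RepRing G →ₗ[ℂ] (G → ℂ) :=
  (repRelations G).liftQ (Finsupp.linearCombination ℂ fun V : FinRep G => V.ρ.character) (by
    rw [repRelations, Submodule.span_le]
    rintro _ ⟨V, A, B, ⟨e⟩, rfl⟩
    rw [SetLike.mem_coe, LinearMap.mem_ker]
    simp only [map_sub, Finsupp.linearCombination_single, one_smul]
    rw [Representation.char_iso e]
    ext g
    have : (A.ρ.prod B.ρ).character g = A.ρ.character g + B.ρ.character g :=
      LinearMap.trace_prodMap' _ _
    simp [this])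

theorem ch_cls (V : FinRep G) : ch (cls V) = V.ρ.character := by
  simp [ch, cls]

theorem ch_Res (φ : G →* H) (x : RepRing H) (g : G) : ch (Res φ x) g = ch x (φ g) := by
  have : LinearMap.proj g ∘ₗ ch ∘ₗ Res φ = LinearMap.proj (φ g) ∘ₗ ch := by
    refine hom_ext fun V => ?_
    simp only [LinearMap.comp_apply, Res_cls, ch_cls, LinearMap.proj_apply]
    rfl
  exact LinearMap.congr_fun this x

theorem ch_eq_of_isConj {a b : G} (h : IsConj a b) (x : RepRing G) : ch x a = ch x b := by
  have : (LinearMap.proj a ∘ₗ ch : RepRing G →ₗ[ℂ] ℂ) = LinearMap.proj b ∘ₗ ch := by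
    refine hom_ext fun V => ?_
    obtain ⟨y, rfl⟩ := isConj_iff.mp h
    simp [ch_cls]
  exact LinearMap.congr_fun this x

theorem ch_Ind_Res [Finite G] [Finite H] (φ : G →* H) (x : RepRing H) :
    ch (Ind φ (Res φ x)) = (fun h => (permChar φ h : ℂ)) * ch x := by
  have : ch ∘ₗ Ind φ ∘ₗ Res φ = LinearMap.mulLeft ℂ (fun h => (permChar φ h : ℂ)) ∘ₗ ch := by
    refine hom_ext fun V => ?_
    simp only [LinearMap.comp_apply, Res_cls, Ind_cls, ch_cls, LinearMap.mulLeft_apply]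
    exact funext fun h => Representation.character_ind_of_comp φ V.ρ h
  exact LinearMap.congr_fun this x

theorem ch_aeval (T : Module.End ℂ (RepRing G)) (P : G → ℂ) (hT : ∀ x, ch (T x) = P * ch x)
    (p : ℂ[X]) (x : RepRing G) : ch (aeval T p x) = aeval P p * ch x := by
  induction p using Polynomial.induction_on generalizing x with
  | C a => simp [Module.algebraMap_end_apply, Algebra.smul_def]
  | add p q hp hq => simp [hp, hq, add_mul]
  | monomial n a h =>
    rw [pow_succ, ← mul_assoc, map_mul (aeval T), map_mul (aeval P), Module.End.mul_apply, h,
      aeval_X, hT, aeval_X, mul_assoc]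

/-- If `Res` is onto then `φ` reflects conjugacy. -/
theorem isConj_of_Res_surjective [Finite G] {φ : G →* H} (hφ : Function.Surjective (Res φ))
    {a b : G} (h : IsConj (φ a) (φ b)) : IsConj a b := by
  refine isConj_of_forall_character_eq fun V => ?_
  obtain ⟨x, hx⟩ := hφ (cls V)
  rw [← ch_cls, ← hx, ch_Res, ch_Res, ch_eq_of_isConj h]

end RepRing

/-! ### Property (*) as an identity of character values -/

namespace GroupChain

variable {S : GroupChain.{u}}

theorem chiIndTriv_eq (n : ℕ) (x : S.G n) :
    S.chiIndTriv n x = (permChar (S.incl (Nat.sub_le n 1)) x : ℚ) := by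
  have := Representation.character_ind_of_comp (S.incl (Nat.sub_le n 1))
    (Representation.trivial ℂ (S.G n) ℂ) x
  rw [Representation.character_trivial_complex, mul_one] at this
  exact this

theorem IsSurjective.isConj (hS : S.IsSurjective) {m n : ℕ} (hmn : m ≤ n) (a b : S.G m)
    (h : IsConj (S.incl hmn a) (S.incl hmn b)) : IsConj a b := by
  induction n, hmn using Nat.le_induction with
  | base => rwa [S.incl_refl, S.incl_refl] at h
  | succ n hmn ih =>
    rw [← S.incl_trans hmn (Nat.le_succ n), ← S.incl_trans hmn (Nat.le_succ n)] at h
    exact ih (RepRing.isConj_of_Res_surjective (hS n) h)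

theorem HasPolynomials.eval_permChar {f : ℕ → ℚ[X]} (hf : S.HasPolynomials f) {l m p n : ℕ}
    (hl : 1 ≤ l) (hm : m + l = n) (hp : p + 1 = n) (hmn : m ≤ n) (hpn : p ≤ n) (x : S.G n) :
    (f l).eval (permChar (S.incl hpn) x) = permChar (S.incl hmn) x := by
  obtain rfl : m = n - l := by omega
  obtain rfl : p = n - 1 := by omega
  -- The trivial representation, lifted because carriers of `FinRep` live in universe `u`.
  let V : FinRep (S.G n) :=
    { V := ULift.{u} ℂ, ρ := Representation.trivial ℂ (S.G n) (ULift.{u} ℂ) }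
  have hV : V.ρ.character x = 1 := by
    change LinearMap.trace ℂ (ULift.{u} ℂ) LinearMap.id = 1
    rw [LinearMap.trace_id, finrank_ulift, Module.finrank_self, Nat.cast_one]
  have h : RepRing.ch (S.indRes l n (RepRing.cls V)) x =
      RepRing.ch (aeval (S.indRes 1 n) ((f l).map (algebraMap ℚ ℂ)) (RepRing.cls V)) x := by
    rw [hf l n hl (by omega)]
  rw [RepRing.ch_aeval (S.indRes 1 n) _ (RepRing.ch_Ind_Res (S.incl (Nat.sub_le n 1))),
    indRes, LinearMap.comp_apply, RepRing.ch_Ind_Res, RepRing.ch_cls, Pi.mul_apply, Pi.mul_apply, hV, mul_one, mul_one,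
    aeval_map_algebraMap] at h
  have h2 : aeval (fun y => (permChar (S.incl (Nat.sub_le n 1)) y : ℂ)) (f l) x =
      aeval (permChar (S.incl (Nat.sub_le n 1)) x : ℂ) (f l) :=
    (aeval_algHom_apply (Pi.evalAlgHom ℚ (fun _ => ℂ) x) _ _).symm
  rw [h2, ← eq_ratCast (algebraMap ℚ ℂ), ← eq_ratCast (algebraMap ℚ ℂ),
    aeval_algebraMap_apply] at h
  exact ((algebraMap ℚ ℂ).injective h).symm

end GroupChain

/-! ### Sequences constrained by a polynomial -/

section Sequences

/-- The map x ↦ p(x)/x sends c_{k+1} to c_k, so the shifted sequence has at least as many values as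
c. By finiteness it has the same values, and c_0 = c_{j+1} for some j. -/
theorem eval_zeroth_ne_zero_of_finite_range {c : ℕ → ℚ} (hfin : (Set.range c).Finite) {p : ℚ[X]}
    (hp : ∀ k, p.eval (c (k + 1)) = c (k + 1) * c k) (hc : ∀ k, c k ≠ 0) : p.eval (c 0) ≠ 0 := by
  let A := Set.range fun k => c (k + 1)
  have hA : A ⊆ Set.range c := by
    rintro _ ⟨k, rfl⟩
    exact ⟨k + 1, rfl⟩
  have hsub : Set.range c ⊆ (fun x => p.eval x / x) '' A := by
    rintro _ ⟨k, rfl⟩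
    exact ⟨c (k + 1), ⟨k, rfl⟩, by simp only [hp]; rw [mul_div_cancel_left₀ _ (hc _)]⟩
  have hle : (Set.range c).ncard ≤ A.ncard :=
    (Set.ncard_le_ncard hsub ((hfin.subset hA).image _)).trans
      (Set.ncard_image_le (hfin.subset hA))
  have heq : A = Set.range c := Set.eq_of_subset_of_ncard_le hA hle hfin
  obtain ⟨j, hj⟩ : c 0 ∈ A := heq ▸ ⟨0, rfl⟩
  simp only at hj
  rw [← hj, hp]
  exact mul_ne_zero (hc _) (hc _)

theorem finite_range_of_forall_le {α : ℕ → ℕ} (M : ℕ) (h : ∀ k, α k ≤ M) :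
    (Set.range α).Finite :=
  (Set.finite_Iic M).subset (by rintro _ ⟨k, rfl⟩; exact h k)

theorem Polynomial.eventually_lt_abs_eval {g : ℚ[X]} (hg : 1 < g.degree) :
    ∃ M : ℕ, ∀ n : ℕ, M ≤ n → g.eval (n : ℚ) ≠ 0 → (n : ℚ) < |g.eval (n : ℚ)| := by
  have h := Polynomial.div_tendsto_atTop_zero_of_degree_lt (X : ℚ[X]) g (by rwa [degree_X])
  have h1 := (h.comp (tendsto_natCast_atTop_atTop (R := ℚ))).abs
  rw [abs_zero] at h1
  obtain ⟨M, hM⟩ := Filter.eventually_atTop.mp (h1.eventually_lt_const one_pos)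
  refine ⟨M, fun n hn h0 => ?_⟩
  have := hM n hn
  simp only [Function.comp_apply, eval_X, abs_div] at this
  rwa [div_lt_one (abs_pos.mpr h0), Nat.abs_cast] at this

/-- Every power of the denominator of B divides D; the exponent |D| is already too large if the
denominator is at least 2. -/
theorem Rat.exists_int_eq_of_forall_pow_mul {B : ℚ} {D : ℤ} (hD : D ≠ 0)
    (h : ∀ n : ℕ, ∃ m : ℤ, B ^ n * D = m) : ∃ b : ℤ, B = b := by
  by_contra hB
  have hden : 2 ≤ B.den := by
    by_contra! hlt
    have h1 : B.den = 1 := by have := B.den_pos; omega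
    exact hB ⟨B.num, (Rat.den_eq_one_iff B).mp h1 |>.symm⟩
  obtain ⟨m, hm⟩ := h D.natAbs
  have hD' : (D : ℚ) ≠ 0 := Int.cast_ne_zero.mpr hD
  have h1 : B ^ D.natAbs = (m / D : ℚ) := by rw [← hm, mul_div_cancel_right₀ _ hD']
  have h2 : ((B ^ D.natAbs).den : ℤ) ∣ D := by
    rw [h1]
    exact_mod_cast Rat.den_dvd m D
  rw [Rat.den_pow, Int.natCast_dvd] at h2
  have h3 := Nat.le_of_dvd (Int.natAbs_pos.mpr hD) h2
  have h4 : D.natAbs < 2 ^ D.natAbs := Nat.lt_two_pow_self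
  have h5 : 2 ^ D.natAbs ≤ B.den ^ D.natAbs := Nat.pow_le_pow_left hden _
  omega

variable {α : ℕ → ℕ}

/-- In degree at least 2, |g(n)| > n for large n with g(n) ≠ 0, so α decreases whenever its next
value is large, and is bounded. -/
theorem natDegree_le_one_of_infinite_range (hpos : ∀ k, 0 < α k) (hinf : (Set.range α).Infinite)
    {g : ℚ[X]} (hg : ∀ k, g.eval (α (k + 1) : ℚ) = α k) : g.natDegree ≤ 1 := by
  by_contra! hdeg
  obtain ⟨M, hM⟩ := Polynomial.eventually_lt_abs_eval (g := g)
    (Polynomial.coe_lt_degree.mpr hdeg)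
  refine hinf (finite_range_of_forall_le (max M (α 0)) fun k => ?_)
  induction k with
  | zero => exact le_max_right _ _
  | succ k ih =>
    rcases le_total M (α (k + 1)) with h | h
    · have := hM _ h (by rw [hg]; exact_mod_cast (hpos k).ne')
      rw [hg, Nat.abs_cast, Nat.cast_lt] at this
      exact this.le.trans ih
    · exact h.trans (le_max_left _ _)

/-- Successive differences are the integers B^n (α 1 - α 0), non-zero since α is not constant; this
forces B to be integral. -/
theorem exists_int_of_rat_recurrence (hinf : (Set.range α).Infinite) {B C : ℚ}
    (h : ∀ k, (α (k + 1) : ℚ) = B * α k + C) :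
    ∃ b c : ℤ, ∀ k, (α (k + 1) : ℚ) = b * α k + c := by
  have hpow (n : ℕ) : (α (n + 1) : ℚ) - α n = B ^ n * (α 1 - α 0) := by
    induction n with
    | zero => simp
    | succ n ih => rw [h (n + 1), pow_succ', mul_assoc, ← ih]; nth_rw 2 [h n]; ring
  have hD : (α 1 : ℤ) - α 0 ≠ 0 := by
    intro h0
    have h0' : (α 1 : ℚ) - α 0 = 0 := by exact_mod_cast h0
    refine hinf (finite_range_of_forall_le (α 0) fun k => ?_)
    induction k with
    | zero => exact le_rfl
    | succ n ih =>
      have := hpow n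
      rw [h0', mul_zero, sub_eq_zero, Nat.cast_inj] at this
      omega
  obtain ⟨b, rfl⟩ := Rat.exists_int_eq_of_forall_pow_mul (B := B) hD fun n =>
    ⟨α (n + 1) - α n, by push_cast; exact (hpow n).symm⟩
  refine ⟨b, α 1 - b * α 0, fun k => ?_⟩
  have h0 := h 0
  rw [h k]
  push_cast
  linarith

theorem exists_int_recurrence (hpos : ∀ k, 0 < α k) (hinf : (Set.range α).Infinite) {p : ℚ[X]}
    (hp0 : p.eval 0 = 0) (hp : ∀ k, p.eval (α (k + 1) : ℚ) = α (k + 1) * α k) :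
    ∃ b c : ℤ, ∀ k, (α (k + 1) : ℚ) = b * α k + c := by
  obtain ⟨g, rfl⟩ : X ∣ p := by rwa [X_dvd_iff, coeff_zero_eq_eval_zero]
  have hg (k : ℕ) : g.eval (α (k + 1) : ℚ) = α k := by
    have := hp k
    rw [eval_mul, eval_X] at this
    exact mul_left_cancel₀ (Nat.cast_ne_zero.mpr (hpos _).ne') this
  have hlin := eq_X_add_C_of_natDegree_le_one (natDegree_le_one_of_infinite_range hpos hinf hg)
  have hg' (k : ℕ) : g.coeff 1 * α (k + 1) + g.coeff 0 = (α k : ℚ) := by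
    rw [← hg k]
    conv_rhs => rw [hlin]
    simp
  have h1 : g.coeff 1 ≠ 0 := by
    intro h1
    refine hinf (finite_range_of_forall_le (α 0) fun k => ?_)
    have h2 := (hg' k).symm.trans ((by rw [h1, zero_mul, zero_mul] : _ = _).trans (hg' 0))
    exact (Nat.cast_injective h2).le
  refine exists_int_of_rat_recurrence hinf (B := 1 / g.coeff 1) (C := - g.coeff 0 / g.coeff 1)
    fun k => ?_
  rw [← hg' k]
  field_simp
  ring

/-- If B ≤ 0, every term after the first is at most C. -/
theorem recurrence_coeff_pos (hinf : (Set.range α).Infinite) {B C : ℤ}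
    (h : ∀ k, (α (k + 1) : ℚ) = B * α k + C) : 0 < B := by
  by_contra! hB
  refine hinf (finite_range_of_forall_le (max (α 0) C.toNat) fun k => ?_)
  cases k with
  | zero => exact le_max_left _ _
  | succ k =>
    refine le_trans ?_ (le_max_right _ _)
    have h1 : (α (k + 1) : ℤ) = B * α k + C := by exact_mod_cast h k
    have h2 : B * (α k : ℤ) ≤ 0 := mul_nonpos_of_nonpos_of_nonneg hB (Int.natCast_nonneg _)
    omega

theorem recurrence_sub_eq {α : ℕ → ℚ} {B C : ℚ} (h : ∀ k, α (k + 1) = B * α k + C) (k j : ℕ) :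
    α (k + j) - (∑ i ∈ Finset.range j, B ^ i) * C = B ^ j * α k := by
  induction j with
  | zero => simp
  | succ j ih =>
    rw [← add_assoc, h, geom_sum_succ, pow_succ', mul_assoc, ← ih]
    ring

theorem polynomial_eq_of_recurrence (hinf : (Set.range α).Infinite) {B C : ℤ} (hB : B ≠ 0)
    (h : ∀ k, (α (k + 1) : ℚ) = B * α k + C) {l : ℕ} {p : ℚ[X]}
    (hp : ∀ k, l ≤ k + 1 → p.eval (α k : ℚ) = ∏ j ∈ Finset.range l, (α (k - j) : ℚ)) :
    p = Polynomial.C (1 / (B : ℚ) ^ (l * (l - 1) / 2)) *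
      ∏ j ∈ Finset.range l, (X - Polynomial.C ((∑ i ∈ Finset.range j, (B : ℚ) ^ i) * C)) := by
  have hB' : (B : ℚ) ≠ 0 := Int.cast_ne_zero.mpr hB
  have hinf' : (α '' Set.Ici l).Infinite := by
    intro hf
    refine hinf ((hf.union ((Set.finite_Iio l).image α)).subset ?_)
    rintro _ ⟨k, rfl⟩
    rcases le_or_gt l k with hk | hk
    · exact Or.inl ⟨k, hk, rfl⟩
    · exact Or.inr ⟨k, hk, rfl⟩
  refine Polynomial.eq_of_infinite_eval_eq _ _
    ((hinf'.image (Nat.cast_injective (R := ℚ)).injOn).mono ?_)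
  rintro _ ⟨_, ⟨k, hk, rfl⟩, rfl⟩
  rw [Set.mem_Ici] at hk
  rw [Set.mem_ofPred_eq, hp k (by omega), eval_mul, eval_C, eval_prod]
  have (j : ℕ) (hj : j ∈ Finset.range l) :
      eval (α k : ℚ) (X - Polynomial.C ((∑ i ∈ Finset.range j, (B : ℚ) ^ i) * C)) =
        (B : ℚ) ^ j * α (k - j) := by
    rw [Finset.mem_range] at hj
    rw [← recurrence_sub_eq (α := fun k => (α k : ℚ)) h (k - j) j, Nat.sub_add_cancel (by omega), eval_sub, eval_X,
      eval_C]
  rw [Finset.prod_congr rfl this, Finset.prod_mul_distrib, Finset.prod_pow_eq_pow_sum,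
    Finset.sum_range_id, ← mul_assoc, one_div_mul_cancel (pow_ne_zero _ hB'), one_mul]

end Sequences

/-! ### Centralizer indices, the recurrence and the roots -/

namespace GroupChain

variable {S : GroupChain.{u}}

theorem order_pos (n : ℕ) : 0 < S.order n := Nat.card_pos

variable (S) in
/-- The order of the centralizer in `G n` of an element of `G m`, `m ≤ n`. -/
noncomputable def centCard {m n : ℕ} (hmn : m ≤ n) (h : S.G m) : ℕ :=
  Nat.card (Subgroup.centralizer {S.incl hmn h})

theorem centCard_pos {m n : ℕ} (hmn : m ≤ n) (h : S.G m) : 0 < S.centCard hmn h := Nat.card_pos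

theorem classCard_pos {m n : ℕ} (hmn : m ≤ n) (h : S.G m) : 0 < S.classCard hmn h :=
  card_conjugatesOf_pos _

theorem classCard_mul_centCard {m n : ℕ} (hmn : m ≤ n) (h : S.G m) :
    S.classCard hmn h * S.centCard hmn h = S.order n :=
  card_conjugatesOf_mul_card_centralizer _

theorem centCard_dvd {m p n : ℕ} (hmp : m ≤ p) (hpn : p ≤ n) (h : S.G m) :
    S.centCard hmp h ∣ S.centCard (hmp.trans hpn) h := by
  rw [centCard, centCard, ← S.incl_trans hmp hpn]
  exact card_centralizer_dvd (S.incl_injective hpn) _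

theorem classCard_le {m p n : ℕ} (hmp : m ≤ p) (hpn : p ≤ n) (h : S.G m) :
    S.classCard hmp h ≤ S.classCard (hmp.trans hpn) h := by
  rw [classCard, classCard, ← S.incl_trans hmp hpn]
  exact card_conjugatesOf_le (S.incl_injective hpn) _

theorem centCard_one {m n : ℕ} (hmn : m ≤ n) : S.centCard hmn 1 = S.order n := by
  rw [centCard, map_one]
  have : Subgroup.centralizer {(1 : S.G n)} = ⊤ := by
    ext x
    simp [Subgroup.mem_centralizer_singleton_iff]
  rw [this, Subgroup.card_top, order]

theorem IsSurjective.permChar_incl (hS : S.IsSurjective) {m p n : ℕ} (hmp : m ≤ p) (hpn : p ≤ n)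
    (hmn : m ≤ n) (h : S.G m) : permChar (S.incl hpn) (S.incl hmn h) =
      (S.centCard hmn h : ℚ) / S.centCard hmp h := by
  rw [centCard, ← S.incl_trans hmp hpn, permChar_apply_of_reflects (hS.isConj hpn), centCard]

variable (S) in
/-- The index of the centralizer in `G (m + k)` of an element of `G m` in its centralizer in
`G (m + k + 1)`. -/
noncomputable def centIndex {m : ℕ} (h : S.G m) (k : ℕ) : ℕ :=
  S.centCard (Nat.le_add_right m (k + 1)) h / S.centCard (Nat.le_add_right m k) h

theorem cast_centIndex {m : ℕ} (h : S.G m) (k : ℕ) : (S.centIndex h k : ℚ) =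
    (S.centCard (Nat.le_add_right m (k + 1)) h : ℚ) / S.centCard (Nat.le_add_right m k) h :=
  Nat.cast_div (centCard_dvd _ (Nat.le_succ _) h) (Nat.cast_ne_zero.mpr (centCard_pos _ h).ne')

theorem centIndex_pos {m : ℕ} (h : S.G m) (k : ℕ) : 0 < S.centIndex h k :=
  Nat.div_pos (Nat.le_of_dvd (centCard_pos _ h) (centCard_dvd _ (Nat.le_succ _) h))
    (centCard_pos _ h)

theorem IsSurjective.permChar_eq_centIndex (hS : S.IsSurjective) {m : ℕ} (h : S.G m) (k : ℕ) :
    permChar (S.incl (Nat.le_succ (m + k))) (S.incl (Nat.le_add_right m (k + 1)) h) =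
      S.centIndex h k := by
  rw [cast_centIndex, hS.permChar_incl (Nat.le_add_right m k)]

/-- The centralizer ratio over two levels telescopes. -/
theorem HasPolynomials.eval_two_centIndex {f : ℕ → ℚ[X]} (hf : S.HasPolynomials f)
    (hS : S.IsSurjective) {m : ℕ} (h : S.G m) (k : ℕ) :
    (f 2).eval (S.centIndex h (k + 1) : ℚ) = S.centIndex h (k + 1) * S.centIndex h k := by
  rw [← hS.permChar_eq_centIndex, hf.eval_permChar one_le_two (m := m + k) rfl rfl
    (Nat.le_add_right _ 2), hS.permChar_incl (Nat.le_add_right m k),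
    hS.permChar_eq_centIndex, cast_centIndex, cast_centIndex]
  have h1 : (S.centCard (Nat.le_add_right m (k + 1)) h : ℚ) ≠ 0 :=
    Nat.cast_ne_zero.mpr (centCard_pos _ h).ne'
  rw [div_mul_div_cancel₀ h1]

/-- Conjugacy is reflected, so h does not become conjugate into G m inside G (m+2), and that
permutation character vanishes at h. -/
theorem HasPolynomials.eval_two_centIndex_zero {f : ℕ → ℚ[X]} (hf : S.HasPolynomials f)
    (hS : S.IsSurjective) {m : ℕ} {h : S.G (m + 1)}
    (hh : ∀ g, ¬ IsConj (S.incl (Nat.le_succ m) g) h) :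
    (f 2).eval (S.centIndex h 0 : ℚ) = 0 := by
  rw [← hS.permChar_eq_centIndex, hf.eval_permChar one_le_two (m := m) rfl rfl
    (Nat.le_add_right _ 2)]
  refine permChar_eq_zero fun g hg => hh g ?_
  rw [← S.incl_trans (Nat.le_succ m) (Nat.le_succ (m + 1))] at hg
  exact hS.isConj _ _ _ hg

/-- By orbit-stabilizer, this says that the class of h can only grow along the chain. -/
theorem centIndex_le {m : ℕ} (h : S.G m) (k : ℕ) : (S.centIndex h k : ℚ) ≤ S.a (m + k + 1) := by
  have h1 := classCard_mul_centCard (Nat.le_add_right m k) h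
  have h2 := classCard_mul_centCard (Nat.le_add_right m (k + 1)) h
  have h3 : (0 : ℚ) < S.centCard (Nat.le_add_right m k) h := Nat.cast_pos.mpr (centCard_pos _ h)
  have h4 : (0 : ℚ) < S.classCard (Nat.le_add_right m k) h := Nat.cast_pos.mpr (classCard_pos _ h)
  have h5 : (S.classCard (Nat.le_add_right m k) h : ℚ) ≤
      S.classCard (Nat.le_add_right m (k + 1)) h :=
    Nat.cast_le.mpr (classCard_le _ (Nat.le_succ _) h)
  change _ ≤ (S.order (m + (k + 1)) : ℚ) / S.order (m + k)
  rw [cast_centIndex, ← h1, ← h2, Nat.cast_mul, Nat.cast_mul, div_le_div_iff₀ h3 (by positivity),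
    mul_left_comm, ← mul_assoc]
  gcongr

theorem exists_forall_not_isConj_of_a_ne_one {m : ℕ} (ha : S.a (m + 1) ≠ 1) :
    ∃ h : S.G (m + 1), ∀ g, ¬ IsConj (S.incl (Nat.le_succ m) g) h := by
  refine exists_forall_not_isConj fun hs => ha ?_
  have : S.order m = S.order (m + 1) :=
    Nat.card_congr (Equiv.ofBijective _ ⟨S.incl_injective _, hs⟩)
  rw [a, Nat.add_sub_cancel, this, div_self (Nat.cast_ne_zero.mpr (order_pos _).ne')]

variable (S) in
/-- The index of `G k` in `G (k + 1)`. -/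
noncomputable def index (k : ℕ) : ℕ := S.order (k + 1) / S.order k

theorem a_succ (k : ℕ) : S.a (k + 1) = S.index k := by
  refine (Nat.cast_div ?_ (Nat.cast_ne_zero.mpr (order_pos _).ne')).symm
  have := centCard_dvd le_rfl (Nat.le_succ k) (1 : S.G k)
  rwa [centCard_one, centCard_one] at this

theorem index_pos (k : ℕ) : 0 < S.index k := by
  have : (0 : ℚ) < S.index k := by
    rw [← a_succ]
    exact div_pos (Nat.cast_pos.mpr (order_pos _)) (Nat.cast_pos.mpr (order_pos _))
  exact_mod_cast this

theorem image_a : S.a '' Set.Ici 1 = (fun n : ℕ => (n : ℚ)) '' Set.range S.index := by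
  ext x
  constructor
  · rintro ⟨n, hn, rfl⟩
    obtain ⟨k, rfl⟩ := Nat.exists_eq_add_of_le' hn
    exact ⟨_, ⟨k, rfl⟩, (a_succ k).symm⟩
  · rintro ⟨_, ⟨k, rfl⟩, rfl⟩
    exact ⟨k + 1, Nat.le_add_left 1 k, a_succ k⟩

theorem recurrence_iff {B C : ℤ} : (∀ n, 2 ≤ n → S.a n = B * S.a (n - 1) + C) ↔
    ∀ k, (S.index (k + 1) : ℚ) = B * S.index k + C := by
  constructor
  · intro h k
    rw [← a_succ, ← a_succ]
    exact h (k + 2) (Nat.le_add_left 2 k)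
  · intro h n hn
    obtain ⟨k, rfl⟩ := Nat.exists_eq_add_of_le' hn
    rw [a_succ (k + 1), h, ← a_succ]
    rfl

theorem infinite_range_index (hS : S.IsSurjective) (hconst : ¬ S.IsConstant)
    {f : ℕ → ℚ[X]} (hf : S.HasPolynomials f) : (Set.range S.index).Infinite := by
  intro hfin
  obtain ⟨m, hm⟩ := not_forall.mp hconst
  obtain ⟨h, hh⟩ := exists_forall_not_isConj hm
  refine eval_zeroth_ne_zero_of_finite_range (c := fun k => (S.centIndex h k : ℚ)) ?_
    (hf.eval_two_centIndex hS h) (fun k => Nat.cast_ne_zero.mpr (centIndex_pos h k).ne')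
    (hf.eval_two_centIndex_zero hS hh)
  obtain ⟨M, hM⟩ := hfin.bddAbove
  have := finite_range_of_forall_le (α := S.centIndex h) M fun k => by
    have h1 := centIndex_le h k
    rw [a_succ, Nat.cast_le] at h1
    exact h1.trans (hM ⟨_, rfl⟩)
  refine (this.image (fun n : ℕ => (n : ℚ))).subset ?_
  rintro _ ⟨k, rfl⟩
  exact ⟨_, ⟨k, rfl⟩, rfl⟩

theorem HasPolynomials.eval_index {f : ℕ → ℚ[X]} (hf : S.HasPolynomials f)
    (hS : S.IsSurjective) {l k : ℕ} (hl : 1 ≤ l) (hlk : l ≤ k + 1) :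
    (f l).eval (S.index k : ℚ) = S.order (k + 1) / S.order (k + 1 - l) := by
  have := hf.eval_permChar hl (Nat.sub_add_cancel hlk) rfl (Nat.sub_le _ _) (Nat.le_succ k)
    (S.incl (Nat.sub_le (k + 1) l) 1)
  rw [hS.permChar_incl (by omega), hS.permChar_incl le_rfl, centCard_one, centCard_one,
    centCard_one] at this
  rwa [← a_succ]

theorem order_div_order {l k : ℕ} (hlk : l ≤ k + 1) :
    (S.order (k + 1) : ℚ) / S.order (k + 1 - l) = ∏ j ∈ Finset.range l, (S.index (k - j) : ℚ) := by
  induction l with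
  | zero => simp [(order_pos (k + 1)).ne']
  | succ l ih =>
    rw [Finset.prod_range_succ, ← ih (by omega), ← a_succ]
    obtain ⟨i, rfl⟩ : ∃ i, k = i + l := ⟨k - l, by omega⟩
    rw [show i + l + 1 - l = i + 1 by omega, show i + l + 1 - (l + 1) = i by omega,
      Nat.add_sub_cancel, a, Nat.add_sub_cancel,
      div_mul_div_cancel₀ (Nat.cast_ne_zero.mpr (order_pos _).ne')]

/-- An element of G (k+2) not conjugate into G (k+1) is a zero of both the one-step and the two-step
permutation characters. -/
theorem HasPolynomials.eval_two_zero {f : ℕ → ℚ[X]} (hf : S.HasPolynomials f)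
    (hinf : (Set.range S.index).Infinite) : (f 2).eval 0 = 0 := by
  obtain ⟨k, hk⟩ : ∃ k, S.index (k + 1) ≠ 1 := by
    by_contra! hc
    refine hinf (finite_range_of_forall_le (max 1 (S.index 0)) fun k => ?_)
    cases k with
    | zero => exact le_max_right _ _
    | succ k => exact (hc k).le.trans (le_max_left _ _)
  obtain ⟨h, hh⟩ := exists_forall_not_isConj_of_a_ne_one (S := S) (m := k + 1)
    (by rw [a_succ]; exact_mod_cast hk)
  have := hf.eval_permChar one_le_two (m := k) rfl rfl (Nat.le_add_right _ 2)
    (Nat.le_succ (k + 1)) h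
  rwa [permChar_eq_zero hh, permChar_eq_zero] at this
  intro g hg
  rw [← S.incl_trans (Nat.le_succ k) (Nat.le_succ (k + 1))] at hg
  exact hh _ hg

theorem HasPolynomials.exists_recurrence {f : ℕ → ℚ[X]} (hf : S.HasPolynomials f)
    (hS : S.IsSurjective) (hinf : (Set.range S.index).Infinite) :
    ∃ B C : ℤ, ∀ k, (S.index (k + 1) : ℚ) = B * S.index k + C := by
  refine exists_int_recurrence index_pos hinf (hf.eval_two_zero hinf) fun k => ?_
  rw [hf.eval_index hS one_le_two (Nat.le_add_left 2 k), order_div_order (Nat.le_add_left 2 k),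
    Finset.prod_range_succ, Finset.prod_range_one]
  rfl

theorem HasPolynomials.eq_prod {f : ℕ → ℚ[X]} (hf : S.HasPolynomials f)
    (hS : S.IsSurjective) (hinf : (Set.range S.index).Infinite) {B C : ℤ}
    (h : ∀ k, (S.index (k + 1) : ℚ) = B * S.index k + C) {l : ℕ} (hl : 1 ≤ l) :
    f l = Polynomial.C (1 / (B : ℚ) ^ (l * (l - 1) / 2)) *
      ∏ j ∈ Finset.range l, (X - Polynomial.C ((∑ i ∈ Finset.range j, (B : ℚ) ^ i) * C)) :=
  polynomial_eq_of_recurrence hinf (recurrence_coeff_pos hinf h).ne' h fun k hk => by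
    rw [hf.eval_index hS hl hk, order_div_order hk]

/-- Since f_2(y) = y(y - C)/B, the constraints on f_2 give c_0 = C and c_{k+1} = B c_k + C. -/
theorem HasPolynomials.centIndex_eq {f : ℕ → ℚ[X]} (hf : S.HasPolynomials f)
    (hS : S.IsSurjective) (hinf : (Set.range S.index).Infinite) {B C : ℤ}
    (h : ∀ k, (S.index (k + 1) : ℚ) = B * S.index k + C) {m : ℕ} {x : S.G (m + 1)}
    (hx : ∀ g, ¬ IsConj (S.incl (Nat.le_succ m) g) x) (k : ℕ) :
    (S.centIndex x k : ℚ) = (∑ i ∈ Finset.range (k + 1), (B : ℚ) ^ i) * C := by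
  have hB : (B : ℚ) ≠ 0 := Int.cast_ne_zero.mpr (recurrence_coeff_pos hinf h).ne'
  have hf2 (y : ℚ) : (f 2).eval y = y * (y - C) / B := by
    rw [hf.eq_prod hS hinf h (l := 2) one_le_two, Finset.prod_range_succ, Finset.prod_range_one]
    simp
    ring
  have hne (k : ℕ) : (S.centIndex x k : ℚ) ≠ 0 := Nat.cast_ne_zero.mpr (centIndex_pos x k).ne'
  induction k with
  | zero =>
    have h0 := hf.eval_two_centIndex_zero hS hx
    rw [hf2, div_eq_zero_iff, or_iff_left hB, mul_eq_zero, or_iff_right (hne 0), sub_eq_zero] at h0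
    simp [h0]
  | succ k ih =>
    have h1 := hf.eval_two_centIndex hS x k
    rw [hf2, mul_div_assoc] at h1
    have h2 := mul_left_cancel₀ (hne (k + 1)) h1
    rw [div_eq_iff hB, ih, sub_eq_iff_eq_add] at h2
    rw [h2, geom_sum_succ (n := k + 1)]
    ring

theorem not_isConj_incl_of_subsingleton [Subsingleton (S.G 0)] {n : ℕ} {x : S.G n} (hx : x ≠ 1)
    (g : S.G 0) : ¬ IsConj (S.incl (Nat.zero_le n) g) x := by
  rw [Subsingleton.elim g 1, map_one, isConj_one_right]
  exact hx

theorem HasPolynomials.eval_permChar_eq_zero_iff [Subsingleton (S.G 0)] {f : ℕ → ℚ[X]}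
    (hf : S.HasPolynomials f) {p l : ℕ} (hp : p + 1 = l) (hpl : p ≤ l) (x : S.G l) :
    (f l).eval (permChar (S.incl hpl) x) = 0 ↔ x ≠ 1 := by
  rw [hf.eval_permChar (by omega) (Nat.zero_add l) hp (Nat.zero_le l) hpl]
  constructor
  · rintro h rfl
    have h0 : Nonempty {g // IsConj (S.incl (Nat.zero_le l) g) 1} :=
      ⟨⟨1, by rw [map_one]⟩⟩
    have h1 : (Nat.card {g // IsConj (S.incl (Nat.zero_le l) g) 1} : ℚ) ≠ 0 :=
      Nat.cast_ne_zero.mpr Nat.card_pos.ne'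
    have h2 : (Nat.card (Subgroup.centralizer {(1 : S.G l)}) : ℚ) ≠ 0 :=
      Nat.cast_ne_zero.mpr Nat.card_pos.ne'
    have h3 : (Nat.card (S.G 0) : ℚ) ≠ 0 := Nat.cast_ne_zero.mpr Nat.card_pos.ne'
    exact div_ne_zero (mul_ne_zero h1 h2) h3 h
  · exact fun hx => permChar_eq_zero (not_isConj_incl_of_subsingleton hx)

/-- C is a centralizer index of a non-trivial element of G 1, so C ≥ 1; with B ≥ 1 the indices
increase. -/
theorem HasPolynomials.one_lt_index [Subsingleton (S.G 0)] [Nontrivial (S.G 1)] {f : ℕ → ℚ[X]}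
    (hf : S.HasPolynomials f) (hS : S.IsSurjective) (hinf : (Set.range S.index).Infinite)
    {B C : ℤ} (h : ∀ k, (S.index (k + 1) : ℚ) = B * S.index k + C) (k : ℕ) : 1 < S.index k := by
  obtain ⟨x, hx⟩ := exists_ne (1 : S.G 1)
  have hC := hf.centIndex_eq hS hinf h (x := x) (not_isConj_incl_of_subsingleton hx) 0
  rw [Finset.sum_range_one, pow_zero, one_mul] at hC
  have hC1 : (S.centIndex x 0 : ℤ) = C := by exact_mod_cast hC
  have hC0 := centIndex_pos x 0
  have hB := recurrence_coeff_pos hinf h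
  induction k with
  | zero =>
    have : S.order 0 = 1 := Nat.card_eq_one_iff_unique.mpr ⟨inferInstance, ⟨1⟩⟩
    rw [index, this, Nat.div_one]
    exact Finite.one_lt_card
  | succ k ih =>
    have h1 : (S.index (k + 1) : ℤ) = B * S.index k + C := by exact_mod_cast h k
    have h2 : (S.index k : ℤ) ≤ B * S.index k := le_mul_of_one_le_left (Int.natCast_nonneg _) hB
    omega

theorem HasPolynomials.exists_permChar_eq_of_root [Subsingleton (S.G 0)] [Nontrivial (S.G 1)]
    {f : ℕ → ℚ[X]} (hf : S.HasPolynomials f) (hS : S.IsSurjective)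
    (hinf : (Set.range S.index).Infinite) {p l : ℕ} (hp : p + 1 = l) (hpl : p ≤ l) {z : ℂ}
    (hz : aeval z (f l) = 0) : ∃ x : S.G l, (permChar (S.incl hpl) x : ℂ) = z := by
  obtain ⟨B, C, h⟩ := hf.exists_recurrence hS hinf
  have hB : (B : ℂ) ≠ 0 := Int.cast_ne_zero.mpr (recurrence_coeff_pos hinf h).ne'
  have hroot : ∃ j < l, z = (((∑ i ∈ Finset.range j, (B : ℚ) ^ i) * C : ℚ) : ℂ) := by
    rw [hf.eq_prod hS hinf h (by omega), map_mul, map_prod, mul_eq_zero, aeval_C,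
      eq_ratCast, Finset.prod_eq_zero_iff] at hz
    rcases hz with hz | ⟨j, hj, hz⟩
    · exact absurd hz (by push_cast; exact one_div_ne_zero (pow_ne_zero _ hB))
    · refine ⟨j, Finset.mem_range.mp hj, ?_⟩
      rwa [map_sub, aeval_X, aeval_C, eq_ratCast, sub_eq_zero] at hz
  obtain ⟨j, hj, rfl⟩ := hroot
  -- The witness is taken j levels below G l, in G (m+1). For j = 0 the root is 0 and Ind t vanishes
  -- there; otherwise the root is the centralizer index at k = j - 1.
  obtain ⟨m, rfl⟩ : ∃ m, l = m + 1 + j := ⟨l - 1 - j, by omega⟩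
  obtain ⟨x, hx⟩ := exists_forall_not_isConj_of_a_ne_one (S := S) (m := m)
    (by rw [a_succ]; exact_mod_cast (hf.one_lt_index hS hinf h m).ne')
  refine ⟨S.incl (Nat.le_add_right _ j) x, ?_⟩
  rw [Rat.cast_inj]
  cases j with
  | zero =>
    obtain rfl : p = m := by omega
    rw [S.incl_refl]
    simpa using permChar_eq_zero hx
  | succ k =>
    obtain rfl : p = m + 1 + k := by omega
    exact (hS.permChar_eq_centIndex x k).trans (hf.centIndex_eq hS hinf h hx k)

end GroupChain

namespace GroupChain

variable {S : GroupChain.{u}}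

theorem cast_centCard_div {m p n : ℕ} (hmp : m ≤ p) (hmn : m ≤ n) (h : S.G m) :
    ((((S.centCard hmn h : ℚ) / S.centCard hmp h : ℚ)) : ℂ) =
      ((S.order n : ℂ) * S.classCard hmp h) / ((S.order p : ℂ) * S.classCard hmn h) := by
  have h1 : (S.classCard hmp h : ℂ) ≠ 0 := Nat.cast_ne_zero.mpr (classCard_pos hmp h).ne'
  have h2 : (S.classCard hmn h : ℂ) ≠ 0 := Nat.cast_ne_zero.mpr (classCard_pos hmn h).ne'
  have h3 : (S.centCard hmp h : ℂ) ≠ 0 := Nat.cast_ne_zero.mpr (centCard_pos hmp h).ne'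
  rw [← classCard_mul_centCard hmp h, ← classCard_mul_centCard hmn h]
  push_cast
  field_simp

theorem aeval_chiIndTriv (p : ℚ[X]) (n : ℕ) (x : S.G n) :
    aeval (S.chiIndTriv n x) p = (p.eval (permChar (S.incl (Nat.sub_le n 1)) x) : ℚ) := by
  rw [chiIndTriv_eq, ← eq_ratCast (algebraMap ℚ ℂ), aeval_algebraMap_apply, eq_ratCast]
  rfl

end GroupChain

open GroupChain in
theorem mainTheorem2 (S : GroupChain.{u}) (hsurj : S.IsSurjective) (hconst : ¬ S.IsConstant)
    (f : ℕ → ℚ[X]) (hf : S.HasPolynomials f) :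
    -- (1) the conjugacy class constraints
    (∀ (l n : ℕ) (hl : 1 ≤ l) (hln : l ≤ n) (h : S.G (n - l)),
      S.chiIndTriv n (S.incl (Nat.sub_le n l) h) =
          ((S.order n : ℂ) * S.classCard (Nat.sub_le_sub_left hl n) h) /
            ((S.order (n - 1) : ℂ) * S.classCard (Nat.sub_le n l) h) ∧
        aeval (S.chiIndTriv n (S.incl (Nat.sub_le n l) h)) (f l) =
          ((S.order n : ℂ) * S.classCard (le_refl (n - l)) h) /
            ((S.order (n - l) : ℂ) * S.classCard (Nat.sub_le n l) h)) ∧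
    -- (2) the indices
    (S.a '' Set.Ici 1).Infinite ∧
    (∃ B C : ℤ, ∀ n, 2 ≤ n → S.a n = B * S.a (n - 1) + C) ∧
    -- (3) the polynomials
    (∀ B C : ℤ, (∀ n, 2 ≤ n → S.a n = B * S.a (n - 1) + C) →
      0 < B ∧ ∀ l, 1 ≤ l →
        f l = Polynomial.C (1 / (B : ℚ) ^ (l * (l - 1) / 2)) *
          ∏ j ∈ Finset.range l,
            (X - Polynomial.C ((∑ i ∈ Finset.range j, (B : ℚ) ^ i) * C))) ∧
    -- (4) the roots, when `G 0` is trivial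
    (Subsingleton (S.G 0) →
      (∀ l, 1 ≤ l → ∀ g : S.G l, g ≠ 1 → aeval (S.chiIndTriv l g) (f l) = 0) ∧
      (Nontrivial (S.G 1) → ∀ l, 1 ≤ l →
        {z : ℂ | aeval z (f l) = 0} = S.chiIndTriv l '' {g | g ≠ 1} ∧
        {z : ℂ | aeval z (f l) = 0} = Set.range (S.chiIndTriv l) \ {S.chiIndTriv l 1})) := by
  have hinf := infinite_range_index hsurj hconst hf
  refine ⟨fun l n hl hln h => ⟨?_, ?_⟩, ?_, ?_, fun B C h => ?_, fun h0 => ?_⟩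
  · rw [chiIndTriv_eq, hsurj.permChar_incl (Nat.sub_le_sub_left hl n), cast_centCard_div]
  · rw [aeval_chiIndTriv, hf.eval_permChar hl (Nat.sub_add_cancel hln)
      (Nat.sub_add_cancel (hl.trans hln)) (Nat.sub_le n l), hsurj.permChar_incl le_rfl,
      cast_centCard_div]
  · rw [image_a]
    exact hinf.image Nat.cast_injective.injOn
  · obtain ⟨B, C, h⟩ := hf.exists_recurrence hsurj hinf
    exact ⟨B, C, recurrence_iff.mpr h⟩
  · rw [recurrence_iff] at h
    exact ⟨recurrence_coeff_pos hinf h, fun l hl => hf.eq_prod hsurj hinf h hl⟩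
  · have hroot (l : ℕ) (hl : 1 ≤ l) (g : S.G l) :
        aeval (S.chiIndTriv l g) (f l) = 0 ↔ g ≠ 1 := by
      rw [aeval_chiIndTriv, Rat.cast_eq_zero,
        hf.eval_permChar_eq_zero_iff (Nat.sub_add_cancel hl)]
    refine ⟨fun l hl g => (hroot l hl g).mpr, fun h1 l hl => ?_⟩
    have himage : {z : ℂ | aeval z (f l) = 0} = S.chiIndTriv l '' {g | g ≠ 1} := by
      refine Set.Subset.antisymm (fun z hz => ?_) ?_
      · obtain ⟨x, rfl⟩ := hf.exists_permChar_eq_of_root hsurj hinf (Nat.sub_add_cancel hl)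
          (Nat.sub_le l 1) hz
        rw [← chiIndTriv_eq] at hz ⊢
        exact ⟨x, (hroot l hl x).mp hz, rfl⟩
      · rintro _ ⟨g, hg, rfl⟩
        exact (hroot l hl g).mpr hg
    refine ⟨himage, himage.trans (Set.Subset.antisymm ?_ ?_)⟩
    · rintro _ ⟨g, hg, rfl⟩
      refine ⟨⟨g, rfl⟩, fun h => ?_⟩
      -- f_l vanishes at χ(g) but not at χ(1), so the two values differ.
      have h2 := (hroot l hl g).mpr hg
      rw [Set.mem_singleton_iff.mp h] at h2
      exact (hroot l hl 1).mp h2 rfl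
    · rintro _ ⟨⟨g, rfl⟩, hg⟩
      exact ⟨g, fun h => hg (by rw [h, Set.mem_singleton_iff]), rfl⟩
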